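/- Let $1<p<\infty$, let $N\ge 1$, let $a_1,\dots,a_N\in\mathbb D\setminus\{0\}$ (repetitions allowed), and let $$J(z)=\prod_{k=1}^N\frac{z-a_k}{1-\overline{a_k}z}.$$ Here $H^p$ is the space of holomorphic $f$ on the unit disk $\mathbb D$ with $\|f\|_p=\sup_{0<r<1}\bigl(\frac1{2\pi}\int_0^{2\pi}|f(re^{i\theta})|^p\,d\theta\bigr)^{1/p}<\infty$, and $[J]_p$ is the closure in $H^p$ of the linear span of $\{z^kJ:k\ge 0\}$. All powers below are principal branches. Then $\inf_{h\in H^p}\|1-Jh\|_p$ is attained by exactly one $h^*\in H^p$, and for $z\in\mathbb D$ $$1-J(z)h^*(z)=\bigl(1-\overline{J(0)}J(z)\bigr)^{2/p}.$$ Moreover, there are an integer $d$ with $0\le d\le N-1$ and $w_1,\dots,w_d\in\overline{\mathbb D}\setminus\{0\}$ such that for all $z\in\mathbb D$ $$1-J(z)h^*(z)=(1-|a_1\cdots a_N|^2)^{2/p}\left[\frac{\prod_{k=1}^d(1-\overline{w_k}z)}{\prod_{k=1}^N(1-\overline{a_k}z)}\right]^{2/p}$$ and $$1=(1-|a_1\cdots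 a_N|^2)\,\frac{\prod_{k=1}^d(1-\overline{w_k}a_j)}{\prod_{k=1}^N(1-\overline{a_k}a_j)}\qquad(1\le j\le N).$$ If the $a_j$ are pairwise distinct, these $N$ conditions determine $d\le N-1$ and the nonzero parameters $w_1,\dots,w_d$ up to order. For $N=1$ the formula reads $$1-J(z)h^*(z)=\left[\frac{1-|a_1|^2}{1-\overline{a_1}z}\right]^{2/p}\qquad(z\in\mathbb D).$$ Finally, $\operatorname{dist}_{H^p}(1,[J]_p)=(1-|J(0)|^2)^{1/p}$. -/

import Mathlib

open scoped ENNReal ComplexConjugate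

noncomputable section

namespace Hardy

/-- The open unit disk. -/
def disk : Set ℂ := Metric.ball 0 1

/-- The Hardy norm `sup_{0<r<1} ((1/2π) ∫_0^{2π} |f(r e^{iθ})|^p dθ)^{1/p}`, with values in `[0, ∞]`.
It depends only on the values of `f` in the open unit disk. -/
def hpNorm (p : ℝ) (f : ℂ → ℂ) : ℝ≥0∞ :=
  ⨆ r ∈ Set.Ioo (0 : ℝ) 1,
    (ENNReal.ofReal (2 * Real.pi)⁻¹ *
      ∫⁻ θ in Set.Ioc 0 (2 * Real.pi), ‖f (circleMap 0 r θ)‖ₑ ^ p) ^ (1 / p)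

/-- `f` restricted to the open unit disk belongs to the Hardy space `H^p`. Functions are taken to be
defined on all of `ℂ`, their values off the disk being irrelevant. -/
def MemHp (p : ℝ) (f : ℂ → ℂ) : Prop :=
  DifferentiableOn ℂ f disk ∧ hpNorm p f < ∞

/-- The forward shift `(S f)(z) = z f(z)`. -/
def shift (f : ℂ → ℂ) : ℂ → ℂ := fun z => z * f z

/-- `[f]_p`: the closure in `H^p` of the linear span of `S^k f`, `k = 0, 1, 2, …`. -/
def invariantSubspace (p : ℝ) (f : ℂ → ℂ) : Set (ℂ → ℂ) :=
  {g | MemHp p g ∧ ∀ ε : ℝ≥0∞, 0 < ε →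
    ∃ u ∈ Submodule.span ℂ (Set.range fun k : ℕ => shift^[k] f), hpNorm p (g - u) < ε}

/-- The distance from `f` to the set `M`, in the `H^p` norm. -/
def hpDist (p : ℝ) (f : ℂ → ℂ) (M : Set (ℂ → ℂ)) : ℝ≥0∞ :=
  ⨅ g ∈ M, hpNorm p (f - g)

/-- The finite Blaschke product with zeros `a_1, …, a_N`. -/
def blaschke {N : ℕ} (a : Fin N → ℂ) (z : ℂ) : ℂ :=
  ∏ k, (z - a k) / (1 - conj (a k) * z)

/-- `h` belongs to `H^p` and attains the infimum of `‖1 - J h‖_p` over `H^p`. -/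
def IsExtremal (p : ℝ) (J h : ℂ → ℂ) : Prop :=
  MemHp p h ∧ hpNorm p (1 - J * h) = ⨅ (g : ℂ → ℂ) (_ : MemHp p g), hpNorm p (1 - J * g)

/-- The constant `1 - |a_1 a_2 ⋯ a_N|^2`. -/
def scale {N : ℕ} (a : Fin N → ℂ) : ℝ := 1 - ‖∏ k, a k‖ ^ 2

/-- The rational function `∏ (1 - conj w_k z) / ∏ (1 - conj a_k z)`. -/
def ratio {N d : ℕ} (a : Fin N → ℂ) (w : Fin d → ℂ) (z : ℂ) : ℂ :=
  (∏ k, (1 - conj (w k) * z)) / ∏ k, (1 - conj (a k) * z)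

/-- The conditions `1 = (1 - |a_1 ⋯ a_N|^2) ∏ (1 - conj w_k a_j) / ∏ (1 - conj a_k a_j)` for all `j`. -/
def Consistent {N d : ℕ} (a : Fin N → ℂ) (w : Fin d → ℂ) : Prop :=
  ∀ j, 1 = (scale a : ℂ) * ratio a w (a j)

end Hardy

end

/-! Write `c = J 0`, `F = 1 - conj c * J` and `G = F ^ (2 / p)`, which is `1 - J h` for some bounded
`h`, and let `φ x = |x| ^ p - 1 - p Re (x - 1)` be the Bregman remainder of `|x| ^ p` at `1`. Since
`|G| ^ p = |F| ^ 2`, every `g ∈ H^p` satisfies pointwise on the disk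

  `|1 - J g| ^ p = Re Φ + (1 - |J| ^ 2) Re V + |F| ^ 2 φ ((1 - J g) / G)`

with `Φ` holomorphic, `Re Φ 0 = 1 - |c| ^ 2`, and `V ∈ H^p`. As `J` is inner, the circle means of
the middle term tend to `0`, while those of `Re Φ` are constant. As `φ ≥ 0`, this gives
`‖1 - J g‖ ^ p ≥ 1 - |c| ^ 2`, with equality for `1 - J g = G`; if equality holds, the means of the
last term tend to `0`, which forces `g = h` because `φ` vanishes only at `1`.

For a finite Blaschke product, `F` is a rational function whose numerator has degree at most `N - 1`
and no zeros in the disk, and factoring the numerator gives the product formula.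
-/

namespace Hardy

open Real Set Filter Topology MeasureTheory

/-! ### Circle averages in the disk -/

lemma mem_disk {z : ℂ} : z ∈ disk ↔ ‖z‖ < 1 := by simp [disk]

lemma sphere_subset_disk {r : ℝ} (hr : r ∈ Ioo (0 : ℝ) 1) : Metric.sphere (0 : ℂ) |r| ⊆ disk :=
  fun _ hz => mem_disk.2 <|
    (mem_sphere_zero_iff_norm.1 hz).trans_lt ((abs_of_pos hr.1).trans_lt hr.2)

lemma circleIntegrable_of_continuousOn_disk {E : Type*} [NormedAddCommGroup E] {f : ℂ → E}
    (hf : ContinuousOn f disk) {r : ℝ} (hr : r ∈ Ioo (0 : ℝ) 1) : CircleIntegrable f 0 r :=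
  (hf.mono (abs_of_pos hr.1 ▸ sphere_subset_disk hr)).circleIntegrable hr.1.le

lemma circleAverage_mono_disk {f g : ℂ → ℝ} (hf : ContinuousOn f disk) (hg : ContinuousOn g disk)
    {r : ℝ} (hr : r ∈ Ioo (0 : ℝ) 1) (h : ∀ z ∈ disk, f z ≤ g z) :
    circleAverage f 0 r ≤ circleAverage g 0 r :=
  circleAverage_mono (circleIntegrable_of_continuousOn_disk hf hr)
    (circleIntegrable_of_continuousOn_disk hg hr) fun z hz => h z (sphere_subset_disk hr hz)

lemma circleAverage_add_disk {f g : ℂ → ℝ} (hf : ContinuousOn f disk) (hg : ContinuousOn g disk)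
    {r : ℝ} (hr : r ∈ Ioo (0 : ℝ) 1) :
    circleAverage (fun z => f z + g z) 0 r = circleAverage f 0 r + circleAverage g 0 r :=
  circleAverage_fun_add (circleIntegrable_of_continuousOn_disk hf hr)
    (circleIntegrable_of_continuousOn_disk hg hr)

lemma circleAverage_const_mul (b : ℝ) (f : ℂ → ℝ) (r : ℝ) :
    circleAverage (fun z => b * f z) 0 r = b * circleAverage f 0 r :=
  circleAverage_fun_smul (a := b) (f := f)

lemma diffContOnCl_ball_of_disk {f : ℂ → ℂ} (hf : DifferentiableOn ℂ f disk) {r : ℝ}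
    (hr : r ∈ Ioo (0 : ℝ) 1) : DiffContOnCl ℂ f (Metric.ball 0 |r|) := by
  apply DifferentiableOn.diffContOnCl
  rw [abs_of_pos hr.1, closure_ball _ hr.1.ne']
  exact hf.mono (Metric.closedBall_subset_ball hr.2)

lemma circleAverage_re_eq {f : ℂ → ℂ} (hf : DifferentiableOn ℂ f disk) {r : ℝ}
    (hr : r ∈ Ioo (0 : ℝ) 1) : circleAverage (fun z => (f z).re) 0 r = (f 0).re := by
  rw [← (diffContOnCl_ball_of_disk hf hr).circleAverage]
  exact Complex.reCLM.circleAverage_comp_comm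
    (circleIntegrable_of_continuousOn_disk hf.continuousOn hr)

lemma norm_apply_le_circleAverage {f : ℂ → ℂ} (hf : DifferentiableOn ℂ f disk) {r : ℝ}
    (hr : r ∈ Ioo (0 : ℝ) 1) {w : ℂ} (hw : ‖w‖ < r) :
    ‖f w‖ ≤ (r - ‖w‖)⁻¹ * circleAverage (fun z => ‖f z‖) 0 r := by
  have kernel_le : ∀ θ, ‖(circleMap 0 r θ - 0) / (circleMap 0 r θ - w)‖ ≤ (r - ‖w‖)⁻¹ := fun θ => by
    have hz : ‖circleMap 0 r θ‖ = r := by simp [abs_of_pos hr.1]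
    have hden : r - ‖w‖ ≤ ‖circleMap 0 r θ - w‖ := by
      simpa only [hz] using norm_sub_norm_le (circleMap 0 r θ) w
    have _ : 0 < r - ‖w‖ := sub_pos.2 hw
    rw [sub_zero, norm_div, hz, div_eq_mul_inv, ← one_mul (r - ‖w‖)⁻¹]
    gcongr
    exact hr.2.le
  rw [← (diffContOnCl_ball_of_disk hf hr).circleAverage_smul_div (w := w)
      (by simpa [abs_of_pos hr.1] using hw),
    ← circleAverage_const_mul, circleAverage_def, circleAverage_def, norm_smul, smul_eq_mul,
    Real.norm_of_nonneg (by positivity)]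
  refine mul_le_mul_of_nonneg_left ?_ (by positivity)
  refine intervalIntegral.norm_integral_le_of_norm_le (by positivity)
    (Eventually.of_forall fun θ _ => ?_)
    ((circleIntegrable_of_continuousOn_disk hf.continuousOn.norm hr).const_mul _)
  rw [norm_smul]
  exact mul_le_mul_of_nonneg_right (kernel_le θ) (norm_nonneg _)

lemma Ioo_mem_nhdsLT_one : Ioo (0 : ℝ) 1 ∈ 𝓝[<] 1 := Ioo_mem_nhdsLT one_pos

lemma eqOn_zero_of_tendsto_circleAverage_norm {f : ℂ → ℂ} (hf : DifferentiableOn ℂ f disk)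
    (h : Tendsto (circleAverage (fun z => ‖f z‖) 0) (𝓝[<] 1) (𝓝 0)) : EqOn f 0 disk := by
  intro w hw
  have hw : 0 < 1 - ‖w‖ := sub_pos.2 (mem_disk.1 hw)
  have hlim : Tendsto (fun r => (r - ‖w‖)⁻¹ * circleAverage (fun z => ‖f z‖) 0 r) (𝓝[<] 1)
      (𝓝 ((1 - ‖w‖)⁻¹ * 0)) := by
    refine Tendsto.mul (Tendsto.inv₀ ?_ hw.ne') h
    exact tendsto_nhdsWithin_of_tendsto_nhds (tendsto_id.sub_const _)
  have hle : ∀ᶠ r in 𝓝[<] (1 : ℝ), ‖f w‖ ≤ (r - ‖w‖)⁻¹ * circleAverage (fun z => ‖f z‖) 0 r := by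
    filter_upwards [Ioo_mem_nhdsLT_one, Ioo_mem_nhdsLT (sub_pos.1 hw)] with r hr hwr
    exact norm_apply_le_circleAverage hf hr hwr.1
  simpa using ge_of_tendsto hlim hle

lemma tendsto_zero_of_forall_le_add_mul {ι : Type*} {l : Filter ι} {f δ : ι → ℝ}
    (hf : ∀ᶠ i in l, 0 ≤ f i) (hδ : Tendsto δ l (𝓝 0))
    (h : ∀ ε > 0, ∃ C, ∀ᶠ i in l, f i ≤ ε + C * δ i) : Tendsto f l (𝓝 0) := by
  rw [Metric.tendsto_nhds]
  intro ε hε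
  obtain ⟨C, hC⟩ := h (ε / 2) (half_pos hε)
  have hCδ : Tendsto (fun i => C * δ i) l (𝓝 0) := by simpa using hδ.const_mul C
  filter_upwards [hf, hC, hCδ.eventually_lt_const (half_pos hε)] with i h0 hle hlt
  rw [Real.dist_0_eq_abs, abs_of_nonneg h0]
  linarith

/-! ### The Hardy norm -/

/-- Normalized Lebesgue measure on the unit circle, in the angular coordinate. -/
noncomputable def angleMeasure : Measure ℝ :=
  ENNReal.ofReal (2 * π)⁻¹ • volume.restrict (Ioc 0 (2 * π))

instance : IsProbabilityMeasure angleMeasure where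
  measure_univ := by
    simp only [angleMeasure, Measure.smul_apply, Measure.restrict_apply_univ, Real.volume_Ioc,
      sub_zero, smul_eq_mul]
    rw [← ENNReal.ofReal_mul (by positivity), inv_mul_cancel₀ (by positivity), ENNReal.ofReal_one]

lemma hpNorm_eq_iSup_eLpNorm {p : ℝ} (hp : 0 < p) (f : ℂ → ℂ) :
    hpNorm p f = ⨆ r ∈ Ioo (0 : ℝ) 1,
      eLpNorm (fun θ => f (circleMap 0 r θ)) (ENNReal.ofReal p) angleMeasure := by
  simp only [hpNorm, angleMeasure, eLpNorm_eq_lintegral_rpow_enorm_toReal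
    (ENNReal.ofReal_pos.2 hp).ne' ENNReal.ofReal_ne_top, ENNReal.toReal_ofReal hp.le,
    lintegral_smul_measure, smul_eq_mul]

lemma circleMap_mem_disk {r : ℝ} (hr : r ∈ Ioo (0 : ℝ) 1) (θ : ℝ) : circleMap 0 r θ ∈ disk :=
  sphere_subset_disk hr (circleMap_mem_sphere' 0 r θ)

lemma continuous_comp_circleMap {f : ℂ → ℂ} (hf : ContinuousOn f disk) {r : ℝ}
    (hr : r ∈ Ioo (0 : ℝ) 1) : Continuous fun θ => f (circleMap 0 r θ) :=
  hf.comp_continuous (continuous_circleMap 0 r) (circleMap_mem_disk hr)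

lemma hpNorm_add_le {p : ℝ} (hp : 1 ≤ p) {f g : ℂ → ℂ} (hf : ContinuousOn f disk)
    (hg : ContinuousOn g disk) : hpNorm p (f + g) ≤ hpNorm p f + hpNorm p g := by
  simp only [hpNorm_eq_iSup_eLpNorm (one_pos.trans_le hp)]
  refine iSup₂_le fun r hr => (eLpNorm_add_le
    (continuous_comp_circleMap hf hr).aestronglyMeasurable
    (continuous_comp_circleMap hg hr).aestronglyMeasurable
    (ENNReal.one_le_ofReal.2 hp)).trans ?_
  gcongr
  · exact le_iSup₂ (f := fun r (_ : r ∈ Ioo (0 : ℝ) 1) => eLpNorm (fun θ => f (circleMap 0 r θ))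
      (ENNReal.ofReal p) angleMeasure) r hr
  · exact le_iSup₂ (f := fun r (_ : r ∈ Ioo (0 : ℝ) 1) => eLpNorm (fun θ => g (circleMap 0 r θ))
      (ENNReal.ofReal p) angleMeasure) r hr

lemma hpNorm_mul_le {p : ℝ} (hp : 0 < p) {f : ℂ → ℂ} {B : ℝ} (hf : ∀ z ∈ disk, ‖f z‖ ≤ B)
    (g : ℂ → ℂ) : hpNorm p (f * g) ≤ ENNReal.ofReal B * hpNorm p g := by
  simp only [hpNorm_eq_iSup_eLpNorm hp, ENNReal.mul_iSup]
  refine iSup₂_mono fun r hr => eLpNorm_le_mul_eLpNorm_of_ae_le_mul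
    (Eventually.of_forall fun θ => ?_) _
  rw [Pi.mul_apply, norm_mul]
  exact mul_le_mul_of_nonneg_right (hf _ (circleMap_mem_disk hr θ)) (norm_nonneg _)

lemma hpNorm_le_of_norm_le {p : ℝ} (hp : 0 < p) {f : ℂ → ℂ} {B : ℝ}
    (hf : ∀ z ∈ disk, ‖f z‖ ≤ B) : hpNorm p f ≤ ENNReal.ofReal B := by
  rw [hpNorm_eq_iSup_eLpNorm hp]
  refine iSup₂_le fun r hr => (eLpNorm_le_of_ae_bound
    (Eventually.of_forall fun θ => hf _ (circleMap_mem_disk hr θ))).trans_eq ?_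
  simp

lemma continuousOn_norm_rpow {f : ℂ → ℂ} (hf : ContinuousOn f disk) {p : ℝ} (hp : 0 ≤ p) :
    ContinuousOn (fun z => ‖f z‖ ^ p) disk :=
  hf.norm.rpow_const fun _ _ => Or.inr hp

lemma lintegral_circle_eq {p : ℝ} (hp : 0 ≤ p) {f : ℂ → ℂ} (hf : ContinuousOn f disk) {r : ℝ}
    (hr : r ∈ Ioo (0 : ℝ) 1) :
    ENNReal.ofReal (2 * π)⁻¹ * ∫⁻ θ in Ioc 0 (2 * π), ‖f (circleMap 0 r θ)‖ₑ ^ p =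
      ENNReal.ofReal (circleAverage (fun z => ‖f z‖ ^ p) 0 r) := by
  have hi := circleIntegrable_of_continuousOn_disk (continuousOn_norm_rpow hf hp) hr
  rw [circleAverage_def, smul_eq_mul, ENNReal.ofReal_mul (by positivity),
    intervalIntegral.integral_of_le (by positivity), ofReal_integral_eq_lintegral_ofReal
      ((intervalIntegrable_iff_integrableOn_Ioc_of_le (by positivity)).1 hi)
      (Eventually.of_forall fun θ => by positivity)]
  congr 1
  refine lintegral_congr fun θ => ?_
  rw [← ENNReal.ofReal_rpow_of_nonneg (norm_nonneg _) hp, ofReal_norm]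

lemma hpNorm_le_iff {p : ℝ} (hp : 0 < p) {f : ℂ → ℂ} (hf : ContinuousOn f disk) {B : ℝ}
    (hB : 0 ≤ B) :
    hpNorm p f ≤ ENNReal.ofReal (B ^ (1 / p)) ↔
      ∀ r ∈ Ioo (0 : ℝ) 1, circleAverage (fun z => ‖f z‖ ^ p) 0 r ≤ B := by
  simp only [hpNorm, iSup_le_iff]
  refine forall₂_congr fun r hr => ?_
  rw [lintegral_circle_eq hp.le hf hr, ← ENNReal.ofReal_rpow_of_nonneg hB (by positivity),
    ENNReal.rpow_le_rpow_iff (by positivity), ENNReal.ofReal_le_ofReal_iff hB]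

lemma hpNorm_eq_ofReal_rpow {p : ℝ} (hp : 0 < p) {f : ℂ → ℂ} (h : hpNorm p f < ∞) :
    hpNorm p f = ENNReal.ofReal (((hpNorm p f).toReal ^ p) ^ (1 / p)) := by
  rw [← Real.rpow_mul ENNReal.toReal_nonneg, mul_one_div_cancel hp.ne', Real.rpow_one,
    ENNReal.ofReal_toReal h.ne]

lemma circleAverage_le_hpNorm {p : ℝ} (hp : 0 < p) {f : ℂ → ℂ} (hf : ContinuousOn f disk)
    (h : hpNorm p f < ∞) {r : ℝ} (hr : r ∈ Ioo (0 : ℝ) 1) :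
    circleAverage (fun z => ‖f z‖ ^ p) 0 r ≤ (hpNorm p f).toReal ^ p :=
  (hpNorm_le_iff hp hf (by positivity)).1 (hpNorm_eq_ofReal_rpow hp h).le r hr

lemma MemHp.continuousOn {p : ℝ} {f : ℂ → ℂ} (hf : MemHp p f) : ContinuousOn f disk :=
  hf.1.continuousOn

lemma MemHp.add {p : ℝ} (hp : 1 ≤ p) {f g : ℂ → ℂ} (hf : MemHp p f) (hg : MemHp p g) :
    MemHp p (f + g) :=
  ⟨hf.1.add hg.1, (hpNorm_add_le hp hf.continuousOn hg.continuousOn).trans_lt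
    (ENNReal.add_lt_top.2 ⟨hf.2, hg.2⟩)⟩

/-- The Hardy space `H^∞` of bounded holomorphic functions on the disk. -/
def MemHInfty (f : ℂ → ℂ) : Prop :=
  DifferentiableOn ℂ f disk ∧ ∃ B, ∀ z ∈ disk, ‖f z‖ ≤ B

lemma memHInfty_const (c : ℂ) : MemHInfty fun _ => c :=
  ⟨differentiableOn_const c, ‖c‖, fun _ _ => le_rfl⟩

lemma MemHInfty.memHp {f : ℂ → ℂ} (hf : MemHInfty f) {p : ℝ} (hp : 0 < p) : MemHp p f :=
  ⟨hf.1, let ⟨_, hB⟩ := hf.2; (hpNorm_le_of_norm_le hp hB).trans_lt ENNReal.ofReal_lt_top⟩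

lemma MemHInfty.mul_memHp {f g : ℂ → ℂ} (hf : MemHInfty f) {p : ℝ} (hp : 0 < p)
    (hg : MemHp p g) : MemHp p (f * g) :=
  ⟨hf.1.mul hg.1, let ⟨_, hB⟩ := hf.2
    (hpNorm_mul_le hp hB g).trans_lt (ENNReal.mul_lt_top ENNReal.ofReal_lt_top hg.2)⟩

lemma MemHInfty.comp {φ f : ℂ → ℂ} (hφ : DifferentiableOn ℂ φ (Metric.closedBall 0 1))
    (hf : DifferentiableOn ℂ f disk) (hf1 : ∀ z ∈ disk, ‖f z‖ ≤ 1) : MemHInfty (φ ∘ f) := by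
  have hmaps : MapsTo f disk (Metric.closedBall 0 1) := fun z hz => by simpa using hf1 z hz
  obtain ⟨B, hB⟩ := (isCompact_closedBall (0 : ℂ) 1).exists_bound_of_continuousOn hφ.continuousOn
  exact ⟨hφ.comp hf hmaps, B, fun z hz => hB _ (hmaps hz)⟩

/-! ### The Bregman remainder of the `p`-th power of the norm -/

lemma exists_norm_sub_le_add_mul {E : Type*} [NormedAddCommGroup E] [NormedSpace ℝ E]
    [FiniteDimensional ℝ E] {φ : E → ℝ} (hφ : ConvexOn ℝ univ φ) {x₀ : E} (h₀ : φ x₀ = 0)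
    (hpos : ∀ x, x ≠ x₀ → 0 < φ x) {ε : ℝ} (hε : 0 < ε) :
    ∃ C, 0 ≤ C ∧ ∀ x, ‖x - x₀‖ ≤ ε + C * φ x := by
  have hnonneg : ∀ x, 0 ≤ φ x := fun x => by
    rcases eq_or_ne x x₀ with rfl | hx
    exacts [h₀.ge, (hpos x hx).le]
  have : ProperSpace E := FiniteDimensional.proper ℝ E
  obtain ⟨m, hm, hsphere⟩ := (isCompact_sphere x₀ ε).exists_forall_le'
    ((hφ.continuousOn isOpen_univ).mono (subset_univ _)) (a := 0)
    fun x hx => hpos x (Metric.ne_of_mem_sphere hx hε.ne')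
  refine ⟨ε / m, by positivity, fun x => ?_⟩
  rcases le_or_gt ‖x - x₀‖ ε with hx | hx
  · exact hx.trans (le_add_of_nonneg_right (mul_nonneg (by positivity) (hnonneg x)))
  have hd : 0 < ‖x - x₀‖ := hε.trans hx
  set t := ε / ‖x - x₀‖ with ht
  have ht0 : 0 ≤ t := by positivity
  have hmem : (1 - t) • x₀ + t • x ∈ Metric.sphere x₀ ε := by
    rw [mem_sphere_iff_norm, show (1 - t) • x₀ + t • x - x₀ = t • (x - x₀) by module, norm_smul,
      Real.norm_of_nonneg ht0, ht, div_mul_cancel₀ _ hd.ne']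
  have hconv : m ≤ t * φ x := by
    have := hφ.2 (mem_univ x₀) (mem_univ x) (sub_nonneg.2 ((div_le_one hd).2 hx.le)) ht0
      (sub_add_cancel 1 t)
    rw [h₀, smul_zero, zero_add, smul_eq_mul] at this
    exact (hsphere _ hmem).trans this
  have : ‖x - x₀‖ ≤ ε / m * φ x := by
    rw [ht, div_mul_eq_mul_div, le_div_iff₀ hd] at hconv
    rw [div_mul_eq_mul_div, le_div_iff₀ hm]
    linarith
  linarith

/-- The remainder of the first order expansion of `x ↦ ‖x‖ ^ p` at `x = 1`. -/
noncomputable def bregman (p : ℝ) (x : ℂ) : ℝ := ‖x‖ ^ p - 1 - p * (x - 1).re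

lemma bregman_one (p : ℝ) : bregman p 1 = 0 := by simp [bregman]

lemma bregman_pos {p : ℝ} (hp : 1 < p) {x : ℂ} (hx : x ≠ 1) : 0 < bregman p x := by
  have hre := Complex.re_le_norm x
  simp only [bregman, Complex.sub_re, Complex.one_re]
  by_cases h : ‖x‖ = 1
  · have hre1 : x.re ≠ 1 := fun hre1 => hx <| by
      have him := Complex.sq_norm_sub_sq_re x
      rw [h, hre1, sub_self, eq_comm, sq_eq_zero_iff] at him
      exact Complex.ext hre1 him
    have : x.re < 1 := lt_of_le_of_ne (h ▸ hre) hre1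
    rw [h, Real.one_rpow]
    nlinarith
  · have := one_add_mul_self_lt_rpow_one_add (s := ‖x‖ - 1) (by linarith [norm_nonneg x])
      (sub_ne_zero.2 h) hp
    rw [add_sub_cancel] at this
    nlinarith

lemma bregman_nonneg {p : ℝ} (hp : 1 < p) (x : ℂ) : 0 ≤ bregman p x := by
  rcases eq_or_ne x 1 with rfl | hx
  exacts [(bregman_one p).ge, (bregman_pos hp hx).le]

lemma convexOn_bregman {p : ℝ} (hp : 1 ≤ p) : ConvexOn ℝ univ (bregman p) := by
  have hnorm : ConvexOn ℝ univ fun x : ℂ => ‖x‖ ^ p := by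
    refine ConvexOn.comp (g := fun y : ℝ => y ^ p) ((convexOn_rpow hp).subset ?_ ?_)
      convexOn_univ_norm ?_
    · rintro _ ⟨x, -, rfl⟩
      exact norm_nonneg x
    · exact (isPreconnected_univ.image _ continuous_norm.continuousOn).ordConnected.convex
    · rintro _ ⟨x, -, rfl⟩ y - hxy
      exact Real.rpow_le_rpow (norm_nonneg x) hxy (by linarith)
  have hlin : ConvexOn ℝ univ fun x : ℂ => (-p) * x.re + (p - 1) :=
    (((-p) • Complex.reLm : ℂ →ₗ[ℝ] ℝ).convexOn convex_univ).add_const (p - 1)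
  refine (hnorm.add hlin).congr fun x _ => ?_
  simp only [Pi.add_apply, bregman, Complex.sub_re, Complex.one_re]
  ring

lemma continuous_bregman {p : ℝ} (hp : 1 ≤ p) : Continuous (bregman p) :=
  continuousOn_univ.1 ((convexOn_bregman hp).continuousOn isOpen_univ)

lemma norm_add_rpow_eq_bregman (p : ℝ) {G : ℂ} (hG : G ≠ 0) (v : ℂ) :
    ‖G + v‖ ^ p = ‖G‖ ^ p * (1 + p * (v / G).re + bregman p (1 + v / G)) := by
  have : G + v = G * (1 + v / G) := by field_simp
  rw [this, norm_mul, Real.mul_rpow (norm_nonneg _) (norm_nonneg _), bregman, add_sub_cancel_left]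
  ring

/-! ### Inner functions -/

/-- A holomorphic self-map of the disk whose quadratic means tend to `1` at the boundary. For a
holomorphic self-map this says that the radial limits have modulus `1` almost everywhere, which is
the usual definition of an inner function. -/
structure IsInner (J : ℂ → ℂ) : Prop where
  differentiableOn : DifferentiableOn ℂ J disk
  norm_le_one : ∀ z ∈ disk, ‖J z‖ ≤ 1
  tendsto_circleAverage : Tendsto (circleAverage (fun z => ‖J z‖ ^ 2) 0) (𝓝[<] 1) (𝓝 1)

lemma continuousOn_circleAverage_closedBall {E : Type*} [NormedAddCommGroup E] [NormedSpace ℝ E]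
    {f : ℂ → E} (hf : ContinuousOn f (Metric.closedBall 0 1)) :
    ContinuousOn (circleAverage f 0) (Icc 0 1) :=
  ContinuousOn.circleAverage (hf.mono fun z hz => by simpa using hz.2) fun _ hr => hr.1

lemma isInner_of_norm_eq_one {J : ℂ → ℂ} (hJ : DiffContOnCl ℂ J disk)
    (h : ∀ z, ‖z‖ = 1 → ‖J z‖ = 1) : IsInner J where
  differentiableOn := hJ.differentiableOn
  norm_le_one z hz := by
    refine Complex.norm_le_of_forall_mem_frontier_norm_le Metric.isBounded_ball hJ (fun w hw => ?_)
      (subset_closure hz)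
    exact (h w (by simpa [disk, frontier_ball] using hw)).le
  tendsto_circleAverage := by
    have hJc : ContinuousOn J (Metric.closedBall 0 1) := by
      simpa [disk, closure_ball] using hJ.continuousOn
    have hcont : ContinuousOn (fun z => ‖J z‖ ^ 2) (Metric.closedBall 0 1) := hJc.norm.pow 2
    have hone : circleAverage (fun z => ‖J z‖ ^ 2) 0 1 = 1 :=
      circleAverage_const_on_circle fun z hz => by simp [h z (by simpa using hz)]
    have := continuousOn_circleAverage_closedBall hcont 1 (by simp)
    rw [ContinuousWithinAt, hone] at this
    exact this.mono_left
      (nhdsWithin_le_iff.2 (mem_of_superset Ioo_mem_nhdsLT_one Ioo_subset_Icc_self))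

lemma exists_mul_le_rpow_add_mul {p : ℝ} (hp : 1 < p) {ε : ℝ} (hε : 0 < ε) :
    ∃ C, ∀ x ∈ Icc (0 : ℝ) 1, ∀ y, 0 ≤ y → x * y ≤ ε * y ^ p + C * x := by
  have hp' : 0 < p - 1 := sub_pos.2 hp
  set M := ε⁻¹ ^ (p - 1)⁻¹
  have hM : 0 < M := by positivity
  refine ⟨M, fun x ⟨hx0, hx1⟩ y hy => ?_⟩
  have hyp : 0 ≤ ε * y ^ p := by positivity
  rcases le_or_gt y M with hyM | hyM
  · nlinarith
  have hy0 : 0 < y := hM.trans hyM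
  have : ε⁻¹ ≤ y ^ (p - 1) := by
    rw [← Real.rpow_inv_rpow (inv_nonneg.2 hε.le) hp'.ne']
    exact Real.rpow_le_rpow hM.le hyM.le hp'.le
  have hpow : y ≤ ε * y ^ p := by
    rw [Real.rpow_sub_one hy0.ne', le_div_iff₀ hy0, inv_mul_le_iff₀ hε] at this
    exact this
  nlinarith

lemma one_sub_norm_sq_mem_Icc {w : ℂ} (hw : ‖w‖ ≤ 1) : 1 - ‖w‖ ^ 2 ∈ Icc (0 : ℝ) 1 :=
  ⟨sub_nonneg.2 (pow_le_one₀ (norm_nonneg _) hw), sub_le_self _ (sq_nonneg _)⟩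

namespace IsInner

variable {J : ℂ → ℂ} (hJ : IsInner J)
include hJ

lemma continuousOn : ContinuousOn J disk := hJ.differentiableOn.continuousOn

lemma memHInfty : MemHInfty J := ⟨hJ.differentiableOn, 1, hJ.norm_le_one⟩

lemma continuousOn_one_sub_norm_sq : ContinuousOn (fun z => 1 - ‖J z‖ ^ 2) disk :=
  continuousOn_const.sub (hJ.continuousOn.norm.pow 2)

lemma tendsto_circleAverage_one_sub_norm_sq :
    Tendsto (circleAverage (fun z => 1 - ‖J z‖ ^ 2) 0) (𝓝[<] 1) (𝓝 0) := by
  rw [← sub_self (1 : ℝ)]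
  refine (hJ.tendsto_circleAverage.const_sub 1).congr' ?_
  have hsq : ContinuousOn (fun z => ‖J z‖ ^ 2) disk := hJ.continuousOn.norm.pow 2
  filter_upwards [Ioo_mem_nhdsLT_one] with r hr
  rw [circleAverage_fun_sub (circleIntegrable_of_continuousOn_disk continuousOn_const hr)
    (circleIntegrable_of_continuousOn_disk hsq hr), circleAverage_const]

lemma tendsto_circleAverage_one_sub_norm_sq_mul_norm {p : ℝ} (hp : 1 < p) {v : ℂ → ℂ}
    (hv : MemHp p v) :
    Tendsto (circleAverage (fun z => (1 - ‖J z‖ ^ 2) * ‖v z‖) 0) (𝓝[<] 1) (𝓝 0) := by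
  have hp0 : 0 < p := one_pos.trans hp
  refine tendsto_zero_of_forall_le_add_mul ?_ hJ.tendsto_circleAverage_one_sub_norm_sq
    fun ε hε => ?_
  · filter_upwards [Ioo_mem_nhdsLT_one] with r hr
    exact circleAverage_nonneg_of_nonneg fun z hz => mul_nonneg
      (one_sub_norm_sq_mem_Icc (hJ.norm_le_one z (sphere_subset_disk hr hz))).1 (norm_nonneg _)
  set B := (hpNorm p v).toReal ^ p
  have _ : 0 ≤ B := by positivity
  obtain ⟨C, hC⟩ := exists_mul_le_rpow_add_mul hp (ε := ε / (B + 1)) (by positivity)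
  refine ⟨C, ?_⟩
  filter_upwards [Ioo_mem_nhdsLT_one] with r hr
  have hvp := continuousOn_norm_rpow hv.continuousOn hp0.le
  calc circleAverage (fun z => (1 - ‖J z‖ ^ 2) * ‖v z‖) 0 r
    _ ≤ circleAverage (fun z => ε / (B + 1) * ‖v z‖ ^ p + C * (1 - ‖J z‖ ^ 2)) 0 r :=
        circleAverage_mono_disk (hJ.continuousOn_one_sub_norm_sq.mul hv.continuousOn.norm)
          ((hvp.const_mul _).add (hJ.continuousOn_one_sub_norm_sq.const_mul _)) hr fun z hz =>
            hC _ (one_sub_norm_sq_mem_Icc (hJ.norm_le_one z hz)) _ (norm_nonneg _)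
    _ = ε / (B + 1) * circleAverage (fun z => ‖v z‖ ^ p) 0 r
          + C * circleAverage (fun z => 1 - ‖J z‖ ^ 2) 0 r := by
        rw [circleAverage_add_disk (hvp.const_mul _)
          (hJ.continuousOn_one_sub_norm_sq.const_mul _) hr, circleAverage_const_mul,
          circleAverage_const_mul]
    _ ≤ ε / (B + 1) * (B + 1) + C * circleAverage (fun z => 1 - ‖J z‖ ^ 2) 0 r := by
        gcongr
        linarith [circleAverage_le_hpNorm hp0 hv.continuousOn hv.2 hr]
    _ = _ := by rw [div_mul_cancel₀ _ (by positivity)]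

lemma tendsto_circleAverage_one_sub_norm_sq_mul_re {p : ℝ} (hp : 1 < p) {v : ℂ → ℂ}
    (hv : MemHp p v) :
    Tendsto (circleAverage (fun z => (1 - ‖J z‖ ^ 2) * (v z).re) 0) (𝓝[<] 1) (𝓝 0) := by
  refine squeeze_zero_norm' ?_ (hJ.tendsto_circleAverage_one_sub_norm_sq_mul_norm hp hv)
  filter_upwards [Ioo_mem_nhdsLT_one] with r hr
  have hre := Complex.continuous_re.comp_continuousOn hv.continuousOn
  refine abs_circleAverage_le_circleAverage_abs.trans (circleAverage_mono_disk
    (hJ.continuousOn_one_sub_norm_sq.mul hre).abs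
    (hJ.continuousOn_one_sub_norm_sq.mul hv.continuousOn.norm) hr fun z hz => ?_)
  have h0 := (one_sub_norm_sq_mem_Icc (hJ.norm_le_one z hz)).1
  change |(1 - ‖J z‖ ^ 2) * (v z).re| ≤ (1 - ‖J z‖ ^ 2) * ‖v z‖
  rw [abs_mul, abs_of_nonneg h0]
  exact mul_le_mul_of_nonneg_left (Complex.abs_re_le_norm _) h0

lemma eqOn_zero_of_mul_eqOn_zero {f : ℂ → ℂ} (hf : DifferentiableOn ℂ f disk)
    (h : EqOn (J * f) 0 disk) : EqOn f 0 disk := by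
  rcases (hJ.differentiableOn.analyticOnNhd Metric.isOpen_ball).eq_zero_or_eq_zero_of_mul_eq_zero
    (hf.analyticOnNhd Metric.isOpen_ball) h (convex_ball 0 1).isPreconnected with hJ0 | hf0
  · have hzero : ∀ᶠ r in 𝓝[<] (1 : ℝ), 0 = circleAverage (fun z => ‖J z‖ ^ 2) 0 r := by
      filter_upwards [Ioo_mem_nhdsLT_one] with r hr
      exact (circleAverage_const_on_circle fun z hz => by
        simp [hJ0 z (sphere_subset_disk hr hz)]).symm
    exact absurd (tendsto_nhds_unique hJ.tendsto_circleAverage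
      (tendsto_const_nhds.congr' hzero)) one_ne_zero
  · exact hf0

end IsInner

/-! ### The extremal function -/

/-- The quotient `(1 - (1 - conj c * w) ^ (2 / p)) / w`, with its removable singularity at `w = 0`
filled in. -/
noncomputable def extremalQuotient (p : ℝ) (c : ℂ) : ℂ → ℂ :=
  dslope (fun w => 1 - (1 - conj c * w) ^ ((2 / p : ℝ) : ℂ)) 0

/-- The candidate `h` for the extremal function, determined by
`1 - J h = (1 - conj (J 0) * J) ^ (2 / p)`. -/
noncomputable def extremal (p : ℝ) (J : ℂ → ℂ) (z : ℂ) : ℂ := extremalQuotient p (J 0) (J z)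

lemma one_sub_mul_extremal (p : ℝ) (J : ℂ → ℂ) (z : ℂ) :
    1 - J z * extremal p J z = (1 - conj (J 0) * J z) ^ ((2 / p : ℝ) : ℂ) := by
  have := sub_smul_dslope (fun w => 1 - (1 - conj (J 0) * w) ^ ((2 / p : ℝ) : ℂ)) 0 (J z)
  simp only [sub_zero, smul_eq_mul, mul_zero, Complex.one_cpow, sub_self] at this
  rw [extremal, extremalQuotient, this, sub_sub_cancel]

lemma norm_one_sub_mul_extremal (p : ℝ) (J : ℂ → ℂ) (z : ℂ) :
    ‖1 - J z * extremal p J z‖ = ‖1 - conj (J 0) * J z‖ ^ (2 / p) := by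
  rw [one_sub_mul_extremal, Complex.norm_cpow_real]

lemma norm_one_sub_mul_extremal_rpow {p : ℝ} (hp : p ≠ 0) (J : ℂ → ℂ) (z : ℂ) :
    ‖1 - J z * extremal p J z‖ ^ p = ‖1 - conj (J 0) * J z‖ ^ 2 := by
  rw [norm_one_sub_mul_extremal, ← Real.rpow_mul (norm_nonneg _), div_mul_cancel₀ _ hp,
    Real.rpow_two]

lemma re_conj_mul_le (c : ℂ) {w : ℂ} (hw : ‖w‖ ≤ 1) : (conj c * w).re ≤ ‖c‖ := by
  refine (Complex.re_le_norm _).trans ?_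
  rw [norm_mul, RCLike.norm_conj]
  exact mul_le_of_le_one_right (norm_nonneg _) hw

lemma one_sub_norm_le_norm_one_sub_conj_mul (c : ℂ) {w : ℂ} (hw : ‖w‖ ≤ 1) :
    1 - ‖c‖ ≤ ‖1 - conj c * w‖ := by
  refine le_trans ?_ (Complex.re_le_norm _)
  rw [Complex.sub_re, Complex.one_re]
  exact sub_le_sub_left (re_conj_mul_le c hw) 1

lemma norm_one_sub_conj_mul_le {c w : ℂ} (hc : ‖c‖ ≤ 1) (hw : ‖w‖ ≤ 1) :
    ‖1 - conj c * w‖ ≤ 2 := by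
  have := norm_sub_le 1 (conj c * w)
  rw [norm_mul, RCLike.norm_conj, norm_one] at this
  linarith [mul_le_one₀ hc (norm_nonneg w) hw]

lemma one_sub_conj_mul_mem_slitPlane {c w : ℂ} (hc : ‖c‖ < 1) (hw : ‖w‖ ≤ 1) :
    1 - conj c * w ∈ Complex.slitPlane := by
  refine Or.inl ?_
  simpa using (re_conj_mul_le c hw).trans_lt hc

lemma norm_one_sub_conj_mul_sq (c w : ℂ) :
    ‖1 - conj c * w‖ ^ 2 = 1 + ‖c‖ ^ 2 * ‖w‖ ^ 2 - 2 * (conj c * w).re := by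
  rw [Complex.sq_norm, Complex.sq_norm, Complex.sq_norm, Complex.normSq_sub, Complex.normSq_mul,
    Complex.normSq_conj]
  simp

lemma differentiableOn_one_sub_conj_mul_cpow {c : ℂ} (hc : ‖c‖ < 1) (s : ℂ) :
    DifferentiableOn ℂ (fun w => (1 - conj c * w) ^ s) (Metric.closedBall 0 1) := by
  refine DifferentiableOn.cpow_const (by fun_prop) fun w hw => ?_
  exact one_sub_conj_mul_mem_slitPlane hc (by simpa using hw)

lemma differentiableOn_extremalQuotient (p : ℝ) {c : ℂ} (hc : ‖c‖ < 1) :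
    DifferentiableOn ℂ (extremalQuotient p c) (Metric.closedBall 0 1) :=
  (Complex.differentiableOn_dslope (Metric.closedBall_mem_nhds 0 one_pos)).2
    ((differentiableOn_one_sub_conj_mul_cpow hc _).const_sub 1)

/-- The Bregman remainder of `1 - J g` relative to the extremal value, weighted so as to be the
excess of `‖1 - J g‖ ^ p` over its first order expansion at the extremal function. -/
noncomputable def gap (p : ℝ) (J g : ℂ → ℂ) (z : ℂ) : ℝ :=
  ‖1 - conj (J 0) * J z‖ ^ 2 * bregman p ((1 - J z * g z) / (1 - J z * extremal p J z))

/-- The difference `extremal p J - g` in the weight in which it enters the first order expansion of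
`‖1 - J g‖ ^ p`. -/
noncomputable def weightedDiff (p : ℝ) (J g : ℂ → ℂ) (z : ℂ) : ℂ :=
  (1 - conj (J 0) * J z) / (1 - conj (J 0) * J z) ^ ((2 / p : ℝ) : ℂ) * (extremal p J z - g z)

lemma gap_nonneg {p : ℝ} (hp : 1 < p) (J g : ℂ → ℂ) (z : ℂ) : 0 ≤ gap p J g z :=
  mul_nonneg (sq_nonneg _) (bregman_nonneg hp _)

lemma circleAverage_gap_nonneg {p : ℝ} (hp : 1 < p) (J g : ℂ → ℂ) (r : ℝ) :
    0 ≤ circleAverage (gap p J g) 0 r :=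
  circleAverage_nonneg_of_nonneg fun _ _ => gap_nonneg hp J g _

lemma norm_sq_mul_re_eq (c j x : ℂ) :
    ‖1 - conj c * j‖ ^ 2 * (j * x).re =
      ((j - c) * ((1 - conj c * j) * x)).re
        + (1 - ‖j‖ ^ 2) * (c * ((1 - conj c * j) * x)).re := by
  have hconj : conj (1 - conj c * j) * j = (j - c) + ((1 - ‖j‖ ^ 2 : ℝ) : ℂ) * c := by
    rw [Complex.ofReal_sub, ← Complex.normSq_eq_norm_sq, Complex.normSq_eq_conj_mul_self]
    simp only [map_sub, map_one, map_mul, Complex.conj_conj, Complex.ofReal_one]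
    ring
  rw [← Complex.re_ofReal_mul, ← Complex.re_ofReal_mul, ← Complex.add_re,
    ← Complex.normSq_eq_norm_sq, Complex.normSq_eq_conj_mul_self]
  congr 1
  linear_combination (1 - conj c * j) * x * hconj

/-- With `c = J 0` and `j = J z`, the first summand is the real part of a function holomorphic in
`z`, and the second one vanishes at the boundary if `J` is inner. -/
lemma norm_add_mul_rpow_eq {p : ℝ} {c j G : ℂ} (hG : G ≠ 0)
    (hGp : ‖G‖ ^ p = ‖1 - conj c * j‖ ^ 2) (u : ℂ) :
    ‖G + j * u‖ ^ p =
      (1 + (‖c‖ ^ 2 : ℝ) - (2 : ℝ) * (conj c * j) + p * ((j - c) * ((1 - conj c * j) / G * u))).re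
        + (1 - ‖j‖ ^ 2) * (p * c * ((1 - conj c * j) / G * u) + (-(‖c‖ ^ 2) : ℝ)).re
        + ‖1 - conj c * j‖ ^ 2 * bregman p (1 + j * u / G) := by
  have hre := norm_sq_mul_re_eq c j (u / G)
  rw [norm_add_rpow_eq_bregman p hG, hGp, mul_div_assoc, div_mul_eq_mul_div, mul_div_assoc]
  have hsq := norm_one_sub_conj_mul_sq c j
  simp only [Complex.add_re, Complex.sub_re, Complex.one_re, Complex.ofReal_re, mul_assoc,
    Complex.re_ofReal_mul] at hre hsq ⊢
  linear_combination p * hre + hsq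

namespace IsInner

variable {J : ℂ → ℂ} (hJ : IsInner J) (h0 : ‖J 0‖ < 1) {p : ℝ}
include hJ h0

lemma memHInfty_extremal (p : ℝ) : MemHInfty (extremal p J) :=
  MemHInfty.comp (differentiableOn_extremalQuotient p h0) hJ.differentiableOn hJ.norm_le_one

lemma one_sub_mul_extremal_ne_zero (p : ℝ) {z : ℂ} (hz : z ∈ disk) :
    1 - J z * extremal p J z ≠ 0 := by
  rw [one_sub_mul_extremal]
  refine fun h => Complex.slitPlane_ne_zero ?_ ((Complex.cpow_eq_zero_iff _ _).1 h).1
  exact one_sub_conj_mul_mem_slitPlane h0 (hJ.norm_le_one z hz)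

lemma memHp_weightedDiff (hp : 1 ≤ p) {g : ℂ → ℂ} (hg : MemHp p g) :
    MemHp p (weightedDiff p J g) := by
  have hp0 : 0 < p := by linarith
  have hweight : MemHInfty ((fun w => (1 - conj (J 0) * w) /
      (1 - conj (J 0) * w) ^ ((2 / p : ℝ) : ℂ)) ∘ J) := by
    refine MemHInfty.comp (DifferentiableOn.div (by fun_prop)
      (differentiableOn_one_sub_conj_mul_cpow h0 _) fun w hw h => ?_) hJ.differentiableOn
      hJ.norm_le_one
    exact Complex.slitPlane_ne_zero (one_sub_conj_mul_mem_slitPlane h0 (by simpa using hw))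
      ((Complex.cpow_eq_zero_iff _ _).1 h).1
  have hneg : MemHp p ((fun _ => -1) * g) := (memHInfty_const (-1)).mul_memHp hp0 hg
  convert hweight.mul_memHp hp0 (((hJ.memHInfty_extremal h0 p).memHp hp0).add hp hneg) using 1
  ext z
  simp only [weightedDiff, Pi.mul_apply, Pi.add_apply, Function.comp_apply, neg_one_mul,
    sub_eq_add_neg]

lemma norm_one_sub_mul_rpow_eq (hp : p ≠ 0) (g : ℂ → ℂ) {z : ℂ} (hz : z ∈ disk) :
    ‖1 - J z * g z‖ ^ p =
      (1 + (‖J 0‖ ^ 2 : ℝ) - (2 : ℝ) * (conj (J 0) * J z)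
          + p * ((J z - J 0) * weightedDiff p J g z)).re
        + (1 - ‖J z‖ ^ 2) * (p * J 0 * weightedDiff p J g z + (-(‖J 0‖ ^ 2) : ℝ)).re
        + gap p J g z := by
  have hG := hJ.one_sub_mul_extremal_ne_zero h0 p hz
  have key := norm_add_mul_rpow_eq hG (norm_one_sub_mul_extremal_rpow hp J z)
    (extremal p J z - g z)
  have hsum : 1 - J z * extremal p J z + J z * (extremal p J z - g z) = 1 - J z * g z := by ring
  have hquot : 1 + J z * (extremal p J z - g z) / (1 - J z * extremal p J z) =
      (1 - J z * g z) / (1 - J z * extremal p J z) := by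
    rw [← hsum, add_div, div_self hG]
  rw [hsum, hquot] at key
  rw [key, weightedDiff, gap, one_sub_mul_extremal]

lemma continuousOn_gap (hp : 1 ≤ p) {g : ℂ → ℂ} (hg : ContinuousOn g disk) :
    ContinuousOn (gap p J g) disk := by
  have hJc := hJ.continuousOn
  have hquot : ContinuousOn (fun z => (1 - J z * g z) / (1 - J z * extremal p J z)) disk :=
    (continuousOn_const.sub (hJc.mul hg)).div
      (continuousOn_const.sub (hJc.mul (hJ.memHInfty_extremal h0 p).1.continuousOn))
      fun z hz => hJ.one_sub_mul_extremal_ne_zero h0 p hz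
  exact ((continuousOn_const.sub (continuousOn_const.mul hJc)).norm.pow 2).mul
    ((continuous_bregman hp).comp_continuousOn hquot)

lemma tendsto_circleAverage_sub_circleAverage_gap (hp : 1 < p) {g : ℂ → ℂ} (hg : MemHp p g) :
    Tendsto (fun r => circleAverage (fun z => ‖(1 - J * g) z‖ ^ p) 0 r
      - circleAverage (gap p J g) 0 r) (𝓝[<] 1) (𝓝 (1 - ‖J 0‖ ^ 2)) := by
  have hp0 : 0 < p := one_pos.trans hp
  have hX := hJ.memHp_weightedDiff h0 hp.le hg
  set Φ : ℂ → ℂ := fun z => 1 + (‖J 0‖ ^ 2 : ℝ) - (2 : ℝ) * (conj (J 0) * J z)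
    + p * ((J z - J 0) * weightedDiff p J g z) with hΦ
  set V : ℂ → ℂ := (fun _ => p * J 0) * weightedDiff p J g + fun _ => ((-(‖J 0‖ ^ 2) : ℝ) : ℂ)
  have hΦd : DifferentiableOn ℂ Φ disk :=
    ((hJ.differentiableOn.const_mul _).const_mul _).const_sub _ |>.add
      (((hJ.differentiableOn.sub_const _).mul hX.1).const_mul _)
  have hΦ0 : (Φ 0).re = 1 - ‖J 0‖ ^ 2 := by
    rw [hΦ]
    simp only [sub_self, zero_mul, mul_zero, add_zero, ← Complex.normSq_eq_conj_mul_self,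
      Complex.normSq_eq_norm_sq]
    norm_cast
    ring
  have hV : MemHp p V :=
    ((memHInfty_const _).mul_memHp hp0 hX).add hp.le ((memHInfty_const _).memHp hp0)
  have hΦre : ContinuousOn (fun z => (Φ z).re) disk :=
    Complex.continuous_re.comp_continuousOn hΦd.continuousOn
  have hVre : ContinuousOn (fun z => (1 - ‖J z‖ ^ 2) * (V z).re) disk :=
    hJ.continuousOn_one_sub_norm_sq.mul (Complex.continuous_re.comp_continuousOn hV.continuousOn)
  have hgap := hJ.continuousOn_gap h0 hp.le hg.continuousOn
  have hlim := (hJ.tendsto_circleAverage_one_sub_norm_sq_mul_re hp hV).const_add (1 - ‖J 0‖ ^ 2)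
  rw [add_zero] at hlim
  refine hlim.congr' ?_
  filter_upwards [Ioo_mem_nhdsLT_one] with r hr
  rw [eq_sub_iff_add_eq, ← hΦ0, ← circleAverage_re_eq hΦd hr,
    ← circleAverage_add_disk hΦre hVre hr, ← circleAverage_add_disk (hΦre.fun_add hVre) hgap hr]
  exact circleAverage_congr_sphere fun z hz =>
    (hJ.norm_one_sub_mul_rpow_eq h0 hp0.ne' g (sphere_subset_disk hr hz)).symm

lemma le_hpNorm_one_sub (hp : 1 < p) {g : ℂ → ℂ} (hg : MemHp p g) :
    ENNReal.ofReal ((1 - ‖J 0‖ ^ 2) ^ (1 / p)) ≤ hpNorm p (1 - J * g) := by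
  have hp0 : 0 < p := one_pos.trans hp
  rcases eq_or_ne (hpNorm p (1 - J * g)) ∞ with htop | htop
  · exact htop ▸ le_top
  rw [hpNorm_eq_ofReal_rpow hp0 htop.lt_top]
  refine ENNReal.ofReal_le_ofReal (Real.rpow_le_rpow
    (one_sub_norm_sq_mem_Icc h0.le).1 ?_ (by positivity))
  refine le_of_tendsto (hJ.tendsto_circleAverage_sub_circleAverage_gap h0 hp hg) ?_
  filter_upwards [Ioo_mem_nhdsLT_one] with r hr
  have hcont : ContinuousOn (1 - J * g) disk :=
    continuousOn_const.sub (hJ.continuousOn.mul hg.continuousOn)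
  linarith [circleAverage_le_hpNorm hp0 hcont htop.lt_top hr, circleAverage_gap_nonneg hp J g r]

lemma hpNorm_one_sub_extremal_le (hp : 0 < p) :
    hpNorm p (1 - J * extremal p J) ≤ ENNReal.ofReal ((1 - ‖J 0‖ ^ 2) ^ (1 / p)) := by
  have hcont : ContinuousOn (1 - J * extremal p J) disk :=
    continuousOn_const.sub (hJ.continuousOn.mul (hJ.memHInfty_extremal h0 p).1.continuousOn)
  refine (hpNorm_le_iff hp hcont (one_sub_norm_sq_mem_Icc h0.le).1).2 fun r hr => ?_
  set Ψ : ℂ → ℂ := fun z => ((1 + ‖J 0‖ ^ 2 : ℝ) : ℂ) - (2 : ℝ) * (conj (J 0) * J z)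
  have hΨ : DifferentiableOn ℂ Ψ disk :=
    ((hJ.differentiableOn.const_mul _).const_mul _).const_sub _
  calc circleAverage (fun z => ‖(1 - J * extremal p J) z‖ ^ p) 0 r
    _ ≤ circleAverage (fun z => (Ψ z).re) 0 r := by
        refine circleAverage_mono_disk (continuousOn_norm_rpow hcont hp.le)
          (Complex.continuous_re.comp_continuousOn hΨ.continuousOn) hr fun z hz => ?_
        change ‖1 - J z * extremal p J z‖ ^ p ≤ (Ψ z).re
        have hle : ‖J 0‖ ^ 2 * ‖J z‖ ^ 2 ≤ ‖J 0‖ ^ 2 :=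
          mul_le_of_le_one_right (sq_nonneg _) (pow_le_one₀ (norm_nonneg _) (hJ.norm_le_one z hz))
        rw [norm_one_sub_mul_extremal_rpow hp.ne', norm_one_sub_conj_mul_sq, Complex.sub_re,
          Complex.re_ofReal_mul, Complex.ofReal_re]
        linarith
    _ = 1 - ‖J 0‖ ^ 2 := by
        rw [circleAverage_re_eq hΨ hr, Complex.sub_re, Complex.re_ofReal_mul, Complex.ofReal_re,
          ← Complex.normSq_eq_conj_mul_self, Complex.ofReal_re, Complex.normSq_eq_norm_sq]
        ring

lemma iInf_hpNorm (hp : 1 < p) :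
    ⨅ (g : ℂ → ℂ) (_ : MemHp p g), hpNorm p (1 - J * g) =
      ENNReal.ofReal ((1 - ‖J 0‖ ^ 2) ^ (1 / p)) := by
  have hp0 : 0 < p := one_pos.trans hp
  refine le_antisymm ?_ (le_iInf₂ fun g hg => hJ.le_hpNorm_one_sub h0 hp hg)
  exact (iInf₂_le _ ((hJ.memHInfty_extremal h0 p).memHp hp0)).trans
    (hJ.hpNorm_one_sub_extremal_le h0 hp0)

lemma isExtremal_iff_le (hp : 1 < p) {g : ℂ → ℂ} :
    IsExtremal p J g ↔
      MemHp p g ∧ hpNorm p (1 - J * g) ≤ ENNReal.ofReal ((1 - ‖J 0‖ ^ 2) ^ (1 / p)) := by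
  refine and_congr_right fun hg => ?_
  rw [hJ.iInf_hpNorm h0 hp, le_antisymm_iff, and_iff_left (hJ.le_hpNorm_one_sub h0 hp hg)]

lemma isExtremal_extremal (hp : 1 < p) : IsExtremal p J (extremal p J) :=
  have hp0 : 0 < p := one_pos.trans hp
  (hJ.isExtremal_iff_le h0 hp).2
    ⟨(hJ.memHInfty_extremal h0 p).memHp hp0, hJ.hpNorm_one_sub_extremal_le h0 hp0⟩

lemma tendsto_circleAverage_gap (hp : 1 < p) {g : ℂ → ℂ} (hg : IsExtremal p J g) :
    Tendsto (circleAverage (gap p J g) 0) (𝓝[<] 1) (𝓝 0) := by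
  obtain ⟨hgp, hle⟩ := (hJ.isExtremal_iff_le h0 hp).1 hg
  have hcont : ContinuousOn (1 - J * g) disk :=
    continuousOn_const.sub (hJ.continuousOn.mul hgp.continuousOn)
  have hmean := (hpNorm_le_iff (one_pos.trans hp) hcont (one_sub_norm_sq_mem_Icc h0.le).1).1 hle
  have hlim := (hJ.tendsto_circleAverage_sub_circleAverage_gap h0 hp hgp).const_sub (1 - ‖J 0‖ ^ 2)
  rw [sub_self] at hlim
  refine squeeze_zero' (Eventually.of_forall fun r => circleAverage_gap_nonneg hp J g r) ?_ hlim
  filter_upwards [Ioo_mem_nhdsLT_one] with r hr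
  linarith [hmean r hr]

lemma exists_norm_mul_sub_le (hp : 1 < p) (g : ℂ → ℂ) {ε : ℝ} (hε : 0 < ε) :
    ∃ C, ∀ z ∈ disk, ‖J z * (extremal p J z - g z)‖ ≤ ε + C * gap p J g z := by
  set M : ℝ := 2 ^ (2 / p)
  have hM : 0 < M := by positivity
  set m := (1 - ‖J 0‖) ^ 2
  have hm : 0 < m := pow_pos (sub_pos.2 h0) 2
  obtain ⟨C, hC0, hC⟩ := exists_norm_sub_le_add_mul (convexOn_bregman hp.le) (bregman_one p)
    (fun _ => bregman_pos hp) (ε := ε / M) (by positivity)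
  refine ⟨M * C / m, fun z hz => ?_⟩
  have hG := hJ.one_sub_mul_extremal_ne_zero h0 p hz
  have hGM : ‖1 - J z * extremal p J z‖ ≤ M := by
    rw [norm_one_sub_mul_extremal]
    exact Real.rpow_le_rpow (norm_nonneg _)
      (norm_one_sub_conj_mul_le h0.le (hJ.norm_le_one z hz)) (by positivity)
  have hFm : m ≤ ‖1 - conj (J 0) * J z‖ ^ 2 := pow_le_pow_left₀ (sub_nonneg.2 h0.le)
    (one_sub_norm_le_norm_one_sub_conj_mul _ (hJ.norm_le_one z hz)) 2
  set x := (1 - J z * g z) / (1 - J z * extremal p J z) with hx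
  have hdiff : J z * (extremal p J z - g z) = (1 - J z * extremal p J z) * (x - 1) := by
    rw [hx]
    field_simp
    ring
  calc ‖J z * (extremal p J z - g z)‖
    _ ≤ M * (ε / M + C * bregman p x) := by
        rw [hdiff, norm_mul]
        exact mul_le_mul hGM (hC x) (norm_nonneg _) hM.le
    _ = ε + M * C / m * (m * bregman p x) := by field_simp
    _ ≤ ε + M * C / m * gap p J g z := by
        gcongr
        exact mul_le_mul_of_nonneg_right hFm (bregman_nonneg hp x)

lemma eqOn_extremal (hp : 1 < p) {g : ℂ → ℂ} (hg : IsExtremal p J g) :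
    EqOn g (extremal p J) disk := by
  have hdiff : DifferentiableOn ℂ (extremal p J - g) disk :=
    (hJ.memHInfty_extremal h0 p).1.sub hg.1.1
  have hJdiff : DifferentiableOn ℂ (J * (extremal p J - g)) disk :=
    hJ.differentiableOn.mul hdiff
  have hgap := hJ.continuousOn_gap h0 hp.le hg.1.continuousOn
  suffices hmean : Tendsto (circleAverage (fun z => ‖(J * (extremal p J - g)) z‖) 0) (𝓝[<] 1)
      (𝓝 0) by
    have hzero := hJ.eqOn_zero_of_mul_eqOn_zero hdiff
      (eqOn_zero_of_tendsto_circleAverage_norm hJdiff hmean)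
    exact fun z hz => (sub_eq_zero.1 (hzero hz)).symm
  refine tendsto_zero_of_forall_le_add_mul
    (Eventually.of_forall fun r => circleAverage_nonneg_of_nonneg fun _ _ => norm_nonneg _)
    (hJ.tendsto_circleAverage_gap h0 hp hg) fun ε hε => ?_
  obtain ⟨C, hC⟩ := hJ.exists_norm_mul_sub_le h0 hp g hε
  refine ⟨C, ?_⟩
  filter_upwards [Ioo_mem_nhdsLT_one] with r hr
  calc circleAverage (fun z => ‖(J * (extremal p J - g)) z‖) 0 r
    _ ≤ circleAverage (fun z => ε + C * gap p J g z) 0 r :=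
        circleAverage_mono_disk hJdiff.continuousOn.norm
          (continuousOn_const.add (hgap.const_mul C)) hr hC
    _ = ε + C * circleAverage (gap p J g) 0 r := by
        rw [circleAverage_add_disk continuousOn_const (hgap.const_mul C) hr, circleAverage_const,
          circleAverage_const_mul]

end IsInner

/-! ### The distance to the invariant subspace -/

lemma exists_polynomial_norm_sub_le {f : ℂ → ℂ} {R : ℝ} (hR : 1 < R)
    (hf : DifferentiableOn ℂ f (Metric.closedBall 0 R)) {ε : ℝ} (hε : 0 < ε) :
    ∃ q : Polynomial ℂ, ∀ z ∈ disk, ‖f z - q.eval z‖ ≤ ε := by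
  lift R to NNReal using by linarith
  rw [NNReal.one_lt_coe] at hR
  have hu := (hf.hasFPowerSeriesOnBall (zero_lt_one.trans hR)).tendstoUniformlyOn (r' := 1)
    (by exact_mod_cast hR)
  obtain ⟨n, hn⟩ := (Metric.tendstoUniformlyOn_iff.1 hu ε hε).exists
  refine ⟨∑ k ∈ Finset.range n,
    Polynomial.C ((cauchyPowerSeries f 0 R).coeff k) * Polynomial.X ^ k, fun z hz => ?_⟩
  have heval : (∑ k ∈ Finset.range n,
      Polynomial.C ((cauchyPowerSeries f 0 R).coeff k) * Polynomial.X ^ k).eval z =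
        (cauchyPowerSeries f 0 R).partialSum n z := by
    rw [Polynomial.eval_finsetSum, FormalMultilinearSeries.partialSum]
    refine Finset.sum_congr rfl fun k _ => ?_
    rw [FormalMultilinearSeries.apply_eq_pow_smul_coeff, Polynomial.eval_C_mul,
      Polynomial.eval_pow, Polynomial.eval_X, smul_eq_mul, mul_comm]
  have hdist := hn z (by simpa [disk] using hz)
  rw [dist_eq_norm, zero_add] at hdist
  rw [heval]
  exact hdist.le

lemma exists_dilation_norm_sub_le {f : ℂ → ℂ} (hf : ContinuousOn f (closure disk)) {ε : ℝ}
    (hε : 0 < ε) : ∃ s ∈ Ioo (0 : ℝ) 1, ∀ z ∈ disk, ‖f z - f (s * z)‖ ≤ ε := by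
  have hcompact : IsCompact (closure disk) := Metric.isBounded_ball.isCompact_closure
  obtain ⟨δ, hδ, hfδ⟩ := Metric.uniformContinuousOn_iff.1
    (hcompact.uniformContinuousOn_of_continuous hf) ε hε
  obtain ⟨s, hs, hsδ⟩ : ∃ s ∈ Ioo (0 : ℝ) 1, 1 - s < δ := by
    obtain ⟨s, hs⟩ := exists_between (max_lt one_pos (sub_lt_self 1 hδ))
    exact ⟨s, ⟨(le_max_left _ _).trans_lt hs.1, hs.2⟩,
      sub_lt_comm.1 ((le_max_right _ _).trans_lt hs.1)⟩
  refine ⟨s, hs, fun z hz => ?_⟩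
  have hz1 := (mem_disk.1 hz).le
  have hsz : (s : ℂ) * z ∈ disk := mem_disk.2 <| by
    rw [norm_mul, Complex.norm_real, Real.norm_of_nonneg hs.1.le]
    exact (mul_le_of_le_one_right hs.1.le hz1).trans_lt hs.2
  rw [← dist_eq_norm]
  refine (hfδ z (subset_closure hz) _ (subset_closure hsz) ?_).le
  rw [dist_eq_norm, ← one_sub_mul, norm_mul, ← Complex.ofReal_one, ← Complex.ofReal_sub,
    Complex.norm_real, Real.norm_of_nonneg (sub_nonneg.2 hs.2.le)]
  exact (mul_le_of_le_one_right (sub_nonneg.2 hs.2.le) hz1).trans_lt hsδ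

lemma exists_polynomial_norm_sub_le_of_diffContOnCl {f : ℂ → ℂ} (hf : DiffContOnCl ℂ f disk)
    {ε : ℝ} (hε : 0 < ε) : ∃ q : Polynomial ℂ, ∀ z ∈ disk, ‖f z - q.eval z‖ ≤ ε := by
  obtain ⟨s, hs, hfs⟩ := exists_dilation_norm_sub_le hf.continuousOn (half_pos hε)
  obtain ⟨R, hR, hsR⟩ := exists_between ((one_lt_inv₀ hs.1).2 hs.2)
  have hdil : DifferentiableOn ℂ (fun z => f (s * z)) (Metric.closedBall 0 R) := by
    refine hf.differentiableOn.comp (by fun_prop) fun z hz => mem_disk.2 ?_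
    rw [norm_mul, Complex.norm_real, Real.norm_of_nonneg hs.1.le]
    refine (mul_le_mul_of_nonneg_left (mem_closedBall_zero_iff.1 hz) hs.1.le).trans_lt ?_
    rwa [← lt_inv_mul_iff₀ hs.1, mul_one]
  obtain ⟨q, hq⟩ := exists_polynomial_norm_sub_le hR hdil (half_pos hε)
  refine ⟨q, fun z hz => (norm_sub_le_norm_sub_add_norm_sub _ (f (s * z)) _).trans ?_⟩
  linarith [hfs z hz, hq z hz]

lemma iterate_shift (f : ℂ → ℂ) (k : ℕ) : shift^[k] f = fun z => z ^ k * f z := by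
  induction k with
  | zero => ext z; simp
  | succ k ih =>
    rw [Function.iterate_succ_apply', ih]
    ext z
    rw [shift, pow_succ', mul_assoc]

lemma mem_span_shift_iff {f u : ℂ → ℂ} :
    u ∈ Submodule.span ℂ (range fun k : ℕ => shift^[k] f) ↔
      ∃ q : Polynomial ℂ, u = fun z => q.eval z * f z := by
  constructor
  · intro h
    induction h using Submodule.span_induction with
    | mem x hx =>
      obtain ⟨k, rfl⟩ := hx
      exact ⟨Polynomial.X ^ k, by simp [iterate_shift]⟩
    | zero => exact ⟨0, by ext; simp⟩
    | add x y _ _ hx hy =>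
      obtain ⟨q, rfl⟩ := hx
      obtain ⟨q', rfl⟩ := hy
      exact ⟨q + q', by ext; simp [add_mul]⟩
    | smul b x _ hx =>
      obtain ⟨q, rfl⟩ := hx
      exact ⟨Polynomial.C b * q, by ext; simp [mul_assoc]⟩
  · rintro ⟨q, rfl⟩
    have hsum : (fun z => q.eval z * f z) =
        ∑ k ∈ Finset.range (q.natDegree + 1), q.coeff k • shift^[k] f := by
      ext z
      simp [iterate_shift, Polynomial.eval_eq_sum_range, Finset.sum_mul, mul_assoc]
    rw [hsum]
    exact Submodule.sum_mem _ fun k _ =>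
      Submodule.smul_mem _ _ (Submodule.subset_span ⟨k, rfl⟩)

lemma memHInfty_of_diffContOnCl {f : ℂ → ℂ} (hf : DiffContOnCl ℂ f disk) : MemHInfty f := by
  obtain ⟨B, hB⟩ := Metric.isBounded_ball.isCompact_closure.exists_bound_of_continuousOn
    hf.continuousOn
  exact ⟨hf.differentiableOn, B, fun z hz => hB z (subset_closure hz)⟩

lemma mul_mem_invariantSubspace {J f : ℂ → ℂ} (hJ : MemHInfty J) (hf : DiffContOnCl ℂ f disk)
    {p : ℝ} (hp : 0 < p) : J * f ∈ invariantSubspace p J := by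
  refine ⟨hJ.mul_memHp hp ((memHInfty_of_diffContOnCl hf).memHp hp), fun ε hε => ?_⟩
  obtain ⟨-, B, hB⟩ := hJ
  have hB0 : 0 ≤ B := (norm_nonneg _).trans (hB 0 (mem_disk.2 (by simp)))
  obtain ⟨δ, hδ0, hδ⟩ := ENNReal.lt_iff_exists_nnreal_btwn.1 hε
  rw [ENNReal.coe_pos] at hδ0
  obtain ⟨q, hq⟩ := exists_polynomial_norm_sub_le_of_diffContOnCl hf
    (ε := δ / (B + 1)) (by positivity)
  refine ⟨_, mem_span_shift_iff.2 ⟨q, rfl⟩, lt_of_le_of_lt ?_ hδ⟩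
  rw [← ENNReal.ofReal_coe_nnreal]
  refine hpNorm_le_of_norm_le hp fun z hz => ?_
  calc ‖J z * f z - q.eval z * J z‖
    _ = ‖J z‖ * ‖f z - q.eval z‖ := by rw [mul_comm (q.eval z), ← mul_sub, norm_mul]
    _ ≤ (B + 1) * (δ / (B + 1)) := by
        gcongr
        exacts [(hB z hz).trans (by linarith), hq z hz]
    _ = δ := mul_div_cancel₀ _ (by positivity)

namespace IsInner

variable {J : ℂ → ℂ} (hJ : IsInner J) (h0 : ‖J 0‖ < 1) {p : ℝ}
include hJ h0

lemma le_hpDist (hp : 1 < p) :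
    ENNReal.ofReal ((1 - ‖J 0‖ ^ 2) ^ (1 / p)) ≤ hpDist p 1 (invariantSubspace p J) := by
  refine le_iInf₂ fun g hg => ENNReal.le_of_forall_pos_le_add fun ε hε _ => ?_
  obtain ⟨u, hu, hgu⟩ := hg.2 ε (by exact_mod_cast hε)
  obtain ⟨q, rfl⟩ := mem_span_shift_iff.1 hu
  have hq : MemHInfty fun z => q.eval z :=
    memHInfty_of_diffContOnCl q.differentiable.diffContOnCl
  have hsplit : 1 - J * (fun z => q.eval z) = (1 - g) + (g - fun z => q.eval z * J z) := by
    ext z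
    simp only [Pi.sub_apply, Pi.add_apply, Pi.mul_apply, Pi.one_apply]
    ring
  have hlow := hJ.le_hpNorm_one_sub h0 hp (hq.memHp (one_pos.trans hp))
  rw [hsplit] at hlow
  refine hlow.trans ((hpNorm_add_le hp.le ?_ ?_).trans (add_le_add le_rfl hgu.le))
  · exact continuousOn_const.sub hg.1.continuousOn
  · exact hg.1.continuousOn.sub (hq.1.continuousOn.mul hJ.continuousOn)

lemma hpDist_eq (hJc : DiffContOnCl ℂ J disk) (hp : 1 < p) :
    hpDist p 1 (invariantSubspace p J) = ENNReal.ofReal ((1 - ‖J 0‖ ^ 2) ^ (1 / p)) := by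
  have hp0 : 0 < p := one_pos.trans hp
  have hquot : DiffContOnCl ℂ (extremalQuotient p (J 0)) (Metric.closedBall 0 1) := by
    refine DifferentiableOn.diffContOnCl ?_
    rw [Metric.isClosed_closedBall.closure_eq]
    exact differentiableOn_extremalQuotient p h0
  have hext : DiffContOnCl ℂ (extremal p J) disk :=
    hquot.comp hJc fun z hz => by simpa using hJ.norm_le_one z hz
  refine le_antisymm ?_ (hJ.le_hpDist h0 hp)
  exact (iInf₂_le _ (mul_mem_invariantSubspace hJ.memHInfty hext hp0)).trans
    (hJ.hpNorm_one_sub_extremal_le h0 hp0)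

end IsInner

/-! ### Finite Blaschke products -/

section Blaschke

variable {N : ℕ} {a : Fin N → ℂ}

lemma one_sub_conj_mul_ne_zero {c w : ℂ} (hc : ‖c‖ < 1) (hw : ‖w‖ ≤ 1) : 1 - conj c * w ≠ 0 :=
  Complex.slitPlane_ne_zero (one_sub_conj_mul_mem_slitPlane hc hw)

lemma prod_one_sub_conj_mul_ne_zero (ha : ∀ k, ‖a k‖ < 1) {z : ℂ} (hz : ‖z‖ ≤ 1) :
    ∏ k, (1 - conj (a k) * z) ≠ 0 :=
  Finset.prod_ne_zero_iff.2 fun k _ => one_sub_conj_mul_ne_zero (ha k) hz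

lemma norm_sub_eq_norm_one_sub_conj_mul (c : ℂ) {z : ℂ} (hz : ‖z‖ = 1) :
    ‖z - c‖ = ‖1 - conj c * z‖ := by
  have hzz : conj z * z = 1 := by
    rw [← Complex.normSq_eq_conj_mul_self, Complex.normSq_eq_norm_sq, hz, one_pow,
      Complex.ofReal_one]
  rw [← hzz, ← sub_mul, ← map_sub, norm_mul, RCLike.norm_conj, hz, mul_one]

lemma norm_blaschke_eq_one (ha : ∀ k, ‖a k‖ < 1) {z : ℂ} (hz : ‖z‖ = 1) : ‖blaschke a z‖ = 1 := by
  rw [blaschke, norm_prod]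
  refine Finset.prod_eq_one fun k _ => ?_
  rw [norm_div, norm_sub_eq_norm_one_sub_conj_mul _ hz,
    div_self (norm_ne_zero_iff.2 (one_sub_conj_mul_ne_zero (ha k) hz.le))]

lemma diffContOnCl_blaschke (ha : ∀ k, ‖a k‖ < 1) : DiffContOnCl ℂ (blaschke a) disk := by
  refine DifferentiableOn.diffContOnCl ?_
  rw [disk, closure_ball 0 one_ne_zero]
  refine DifferentiableOn.fun_finsetProd fun k _ => DifferentiableOn.div (by fun_prop) (by fun_prop)
    fun z hz => one_sub_conj_mul_ne_zero (ha k) (by simpa using hz)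

lemma isInner_blaschke (ha : ∀ k, ‖a k‖ < 1) : IsInner (blaschke a) :=
  isInner_of_norm_eq_one (diffContOnCl_blaschke ha) fun _ => norm_blaschke_eq_one ha

lemma blaschke_zero (a : Fin N → ℂ) : blaschke a 0 = ∏ k, -a k := by simp [blaschke]

lemma blaschke_apply_self (a : Fin N → ℂ) (j : Fin N) : blaschke a (a j) = 0 :=
  Finset.prod_eq_zero (Finset.mem_univ j) (by simp)

lemma norm_blaschke_zero (a : Fin N → ℂ) : ‖blaschke a 0‖ = ‖∏ k, a k‖ := by
  simp [blaschke_zero]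

lemma norm_blaschke_zero_lt_one (hN : 1 ≤ N) (ha : ∀ k, ‖a k‖ < 1) : ‖blaschke a 0‖ < 1 := by
  rw [norm_blaschke_zero, norm_prod, ← Finset.mul_prod_erase _ _ (Finset.mem_univ ⟨0, hN⟩)]
  exact mul_lt_one_of_nonneg_of_lt_one_left (norm_nonneg _) (ha _)
    (Finset.prod_le_one (fun _ _ => norm_nonneg _) fun k _ => (ha k).le)

lemma scale_eq (a : Fin N → ℂ) : scale a = 1 - ‖blaschke a 0‖ ^ 2 := by
  rw [scale, norm_blaschke_zero]

lemma scale_pos (hN : 1 ≤ N) (ha : ∀ k, ‖a k‖ < 1) : 0 < scale a := by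
  rw [scale_eq, sub_pos]
  exact pow_lt_one₀ (norm_nonneg _) (norm_blaschke_zero_lt_one hN ha) two_ne_zero

end Blaschke

/-! ### Polynomials normalized at the origin -/

section Polynomial

open Polynomial

variable {K : Type*} [Field K] {ι κ : Type*}

lemma one_sub_C_mul_X_eq {b : K} (hb : b ≠ 0) :
    (1 - C b * X : K[X]) = C (-b) * (X - C b⁻¹) := by
  rw [mul_sub, ← C_mul, neg_mul, mul_inv_cancel₀ hb, C_neg, C_neg, C_1]
  ring

lemma degree_prod_one_sub_C_mul_X_le (s : Finset ι) (b : ι → K) :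
    (∏ i ∈ s, (1 - C (b i) * X) : K[X]).degree ≤ s.card := by
  rw [degree_prod]
  refine (Finset.sum_le_card_nsmul s _ 1 fun i _ => ?_).trans_eq (nsmul_one _)
  compute_degree

lemma coeff_card_prod_one_sub_C_mul_X (s : Finset ι) (b : ι → K) :
    (∏ i ∈ s, (1 - C (b i) * X) : K[X]).coeff s.card = ∏ i ∈ s, -b i := by
  have hdeg : ∀ i ∈ s, (1 - C (b i) * X : K[X]).natDegree ≤ 1 := fun i _ => by compute_degree
  have := coeff_prod_of_natDegree_le s _ 1 hdeg
  rw [mul_one] at this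
  simpa [coeff_one] using this

lemma roots_prod_one_sub_C_mul_X (s : Finset ι) {b : ι → K} (hb : ∀ i, b i ≠ 0) :
    (∏ i ∈ s, (1 - C (b i) * X) : K[X]).roots = s.val.map fun i => (b i)⁻¹ := by
  have hC : ∏ i ∈ s, -b i ≠ 0 := Finset.prod_ne_zero_iff.2 fun i _ => neg_ne_zero.2 (hb i)
  rw [Finset.prod_congr rfl fun i _ => one_sub_C_mul_X_eq (hb i), Finset.prod_mul_distrib,
    ← map_prod, roots_C_mul _ hC, roots_prod _ _ (Finset.prod_ne_zero_iff.2 fun i _ =>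
      X_sub_C_ne_zero _)]
  simp only [roots_X_sub_C, Multiset.bind_singleton]

lemma exists_equiv_of_map_univ_eq {α β γ : Type*} [Fintype α] [Fintype β] {f : α → γ} {g : β → γ}
    (h : (Finset.univ : Finset α).val.map f = (Finset.univ : Finset β).val.map g) :
    ∃ e : α ≃ β, f = g ∘ e := by
  classical
  have hfiber : ∀ c, Nonempty ({a // f a = c} ≃ {b // g b = c}) := fun c => by
    have hcount := congrArg (Multiset.count c) h
    rw [Multiset.count_map, Multiset.count_map] at hcount
    simp only [eq_comm (a := c)] at hcount
    rw [← Fintype.card_eq, Fintype.card_subtype, Fintype.card_subtype]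
    exact hcount
  exact ⟨Equiv.ofFiberEquiv fun c => (hfiber c).some,
    funext fun a => (Equiv.ofFiberEquiv_map _ a).symm⟩

lemma exists_equiv_of_prod_eq [Fintype ι] [Fintype κ] {b : ι → K} {c : κ → K} (hb : ∀ i, b i ≠ 0)
    (hc : ∀ k, c k ≠ 0) (h : (∏ i, (1 - C (b i) * X) : K[X]) = ∏ k, (1 - C (c k) * X)) :
    ∃ e : ι ≃ κ, b = c ∘ e := by
  have hroots := congrArg roots h
  rw [roots_prod_one_sub_C_mul_X _ hb, roots_prod_one_sub_C_mul_X _ hc] at hroots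
  obtain ⟨e, he⟩ := exists_equiv_of_map_univ_eq hroots
  exact ⟨e, funext fun i => inv_injective (congrFun he i)⟩

lemma exists_eq_C_mul_prod_one_sub_C_mul_X [IsAlgClosed K] {n : ℕ} {Q : K[X]}
    (hQ : Q.eval 0 ≠ 0) (hn : Q.natDegree = n) :
    ∃ b : Fin n → K, (∀ k, b k ≠ 0) ∧ Q = C (Q.eval 0) * ∏ k, (1 - C (b k) * X) := by
  induction n generalizing Q with
  | zero =>
    refine ⟨Fin.elim0, fun k => k.elim0, ?_⟩
    rw [Fin.prod_univ_zero, mul_one, ← coeff_zero_eq_eval_zero]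
    exact eq_C_of_natDegree_eq_zero hn
  | succ n ih =>
    obtain ⟨r, hr⟩ := IsAlgClosed.exists_root Q (degree_ne_of_natDegree_ne (n := 0) (by omega))
    have hr0 : r ≠ 0 := by
      rintro rfl
      exact hQ hr
    obtain ⟨q, hq⟩ : (1 - C r⁻¹ * X) ∣ Q := by
      rw [one_sub_C_mul_X_eq (inv_ne_zero hr0), inv_inv,
        C_mul_dvd (neg_ne_zero.2 (inv_ne_zero hr0))]
      exact dvd_iff_isRoot.2 hr
    have heval : Q.eval 0 = q.eval 0 := by simp [hq]
    have hdeg : q.natDegree = n := by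
      have hq0 : q ≠ 0 := by
        rintro rfl
        exact hQ (by simp [hq])
      rw [hq, one_sub_C_mul_X_eq (inv_ne_zero hr0), mul_assoc,
        natDegree_C_mul (neg_ne_zero.2 (inv_ne_zero hr0)),
        natDegree_mul (X_sub_C_ne_zero _) hq0, natDegree_X_sub_C] at hn
      omega
    obtain ⟨b, hb, hprod⟩ := ih (heval ▸ hQ) hdeg
    refine ⟨Fin.cons r⁻¹ b, Fin.cases (inv_ne_zero hr0) hb, ?_⟩
    rw [Fin.prod_univ_succ, Fin.cons_zero, heval, mul_left_comm]
    simp only [Fin.cons_succ]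
    rw [← hprod, hq]

end Polynomial

/-! ### Factorization of `1 - conj (J 0) * J` -/

section Factorization

variable {N : ℕ} {a : Fin N → ℂ}

open Polynomial in
/-- The numerator `∏ (1 - conj a_k X) - conj (J 0) ∏ (X - a_k)` of `1 - conj (J 0) * J`, where `J`
is the Blaschke product with zeros `a_k`. -/
noncomputable def numerator (a : Fin N → ℂ) : ℂ[X] :=
  ∏ k, (1 - C (conj (a k)) * X) - C (conj (blaschke a 0)) * ∏ k, (X - C (a k))

lemma eval_numerator (a : Fin N → ℂ) (z : ℂ) :
    (numerator a).eval z =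
      ∏ k, (1 - conj (a k) * z) - conj (blaschke a 0) * ∏ k, (z - a k) := by
  simp [numerator, Polynomial.eval_prod]

lemma numerator_div_eq (ha : ∀ k, ‖a k‖ < 1) {z : ℂ} (hz : ‖z‖ ≤ 1) :
    (numerator a).eval z / ∏ k, (1 - conj (a k) * z) = 1 - conj (blaschke a 0) * blaschke a z := by
  rw [eval_numerator, sub_div, div_self (prod_one_sub_conj_mul_ne_zero ha hz), mul_div_assoc,
    ← Finset.prod_div_distrib]
  rfl

lemma eval_zero_numerator (a : Fin N → ℂ) : (numerator a).eval 0 = scale a := by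
  have hprod : ∏ k, (0 - a k) = blaschke a 0 := by simp [blaschke_zero]
  rw [eval_numerator, hprod, ← Complex.normSq_eq_conj_mul_self, Complex.normSq_eq_norm_sq, scale_eq]
  simp

open Polynomial in
lemma degree_numerator_lt (a : Fin N → ℂ) : (numerator a).degree < N := by
  set P : ℂ[X] := ∏ k, (1 - C (conj (a k)) * X)
  set P' : ℂ[X] := ∏ k, (X - C (a k))
  have hP : P.degree ≤ N := by
    simpa using degree_prod_one_sub_C_mul_X_le Finset.univ fun k => conj (a k)
  have hP' : P'.degree = N := by simp [P', degree_prod]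
  have hPN : P.coeff N = conj (blaschke a 0) := by
    simpa [blaschke_zero] using
      coeff_card_prod_one_sub_C_mul_X Finset.univ fun k => conj (a k)
  have hPN' : P'.coeff N = 1 := by
    have := (monic_prod_X_sub_C a Finset.univ).coeff_natDegree
    rwa [natDegree_eq_of_degree_eq_some hP'] at this
  have hle : (numerator a).degree ≤ N := by
    rw [numerator, ← smul_eq_C_mul]
    exact (degree_sub_le _ _).trans (max_le hP ((degree_smul_le _ _).trans hP'.le))
  refine hle.lt_of_ne fun h => coeff_ne_zero_of_eq_degree h ?_
  rw [numerator, coeff_sub, coeff_C_mul, hPN, hPN', mul_one, sub_self]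

lemma exists_factor_eq_scale_mul_ratio (hN : 1 ≤ N) (ha : ∀ k, ‖a k‖ < 1) :
    ∃ (d : ℕ) (w : Fin d → ℂ), d ≤ N - 1 ∧ (∀ k, w k ∈ Metric.closedBall (0 : ℂ) 1 \ {0}) ∧
      ∀ z ∈ disk, 1 - conj (blaschke a 0) * blaschke a z = scale a * ratio a w z := by
  have hne : (numerator a).eval 0 ≠ 0 := by
    rw [eval_zero_numerator]
    exact_mod_cast (scale_pos hN ha).ne'
  obtain ⟨b, hb0, hfac⟩ := exists_eq_C_mul_prod_one_sub_C_mul_X hne rfl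
  have heval : ∀ z, (numerator a).eval z = scale a * ∏ k, (1 - b k * z) := fun z => by
    simpa [Polynomial.eval_prod, eval_zero_numerator] using congrArg (Polynomial.eval z) hfac
  refine ⟨_, fun k => conj (b k), ?_, fun k => ⟨?_, by simpa using hb0 k⟩, fun z hz => ?_⟩
  · have := (Polynomial.natDegree_lt_iff_degree_lt fun h => hne (by simp [h])).2
      (degree_numerator_lt a)
    omega
  · by_contra hk
    have hb1 : 1 < ‖b k‖ := by simpa using hk
    have hinv : ‖(b k)⁻¹‖ < 1 := by
      rw [norm_inv]
      exact inv_lt_one_of_one_lt₀ hb1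
    have hzero : (numerator a).eval (b k)⁻¹ = 0 := by
      rw [heval, Finset.prod_eq_zero (Finset.mem_univ k) (by simp [hb0 k]), mul_zero]
    have hquot := numerator_div_eq ha hinv.le
    rw [hzero, zero_div] at hquot
    exact one_sub_conj_mul_ne_zero (norm_blaschke_zero_lt_one hN ha)
      ((isInner_blaschke ha).norm_le_one _ (mem_disk.2 hinv)) hquot.symm
  · rw [← numerator_div_eq ha (mem_disk.1 hz).le, heval, ratio, mul_div_assoc]
    simp only [Complex.conj_conj]

open Polynomial in
lemma Consistent.exists_equiv {d d' : ℕ} {w : Fin d → ℂ} {w' : Fin d' → ℂ} (h : Consistent a w)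
    (h' : Consistent a w') (ha : ∀ k, ‖a k‖ < 1) (hinj : Function.Injective a) (hd : d < N)
    (hd' : d' < N) (hw : ∀ k, w k ≠ 0) (hw' : ∀ k, w' k ≠ 0) :
    ∃ e : Fin d' ≃ Fin d, w' = w ∘ e := by
  have hs : (scale a : ℂ) ≠ 0 := Complex.ofReal_ne_zero.2 (scale_pos (by omega) ha).ne'
  have hdeg : ∀ {n : ℕ} (v : Fin n → ℂ), n < N →
      (∏ k, (1 - C (conj (v k)) * X) : ℂ[X]).degree < (Finset.univ : Finset (Fin N)).card := by
    intro n v hn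
    refine (degree_prod_one_sub_C_mul_X_le _ _).trans_lt ?_
    simpa using hn
  have hprod : (∏ k, (1 - C (conj (w' k)) * X) : ℂ[X]) = ∏ k, (1 - C (conj (w k)) * X) := by
    refine eq_of_degrees_lt_of_eval_index_eq Finset.univ hinj.injOn (hdeg w' hd') (hdeg w hd)
      fun j _ => ?_
    have hratio := mul_left_cancel₀ hs ((h' j).symm.trans (h j))
    rw [ratio, ratio, div_left_inj' (prod_one_sub_conj_mul_ne_zero ha (ha j).le)] at hratio
    simpa [eval_prod] using hratio
  obtain ⟨e, he⟩ := exists_equiv_of_prod_eq (fun k => by simpa using hw' k)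
    (fun k => by simpa using hw k) hprod
  exact ⟨e, funext fun k => (starRingEnd ℂ).injective (congrFun he k)⟩

end Factorization

lemma ofReal_mul_cpow {s : ℝ} (hs : 0 ≤ s) (x t : ℂ) :
    ((s : ℂ) * x) ^ t = (s : ℂ) ^ t * x ^ t := by
  rcases eq_or_ne t 0 with rfl | ht
  · simp only [Complex.cpow_zero, mul_one]
  rcases hs.eq_or_lt with rfl | hs
  · rw [Complex.ofReal_zero, zero_mul, Complex.zero_cpow ht, zero_mul]
  rcases eq_or_ne x 0 with rfl | hx
  · rw [mul_zero, Complex.zero_cpow ht, mul_zero]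
  have hs' : (s : ℂ) ≠ 0 := Complex.ofReal_ne_zero.2 hs.ne'
  rw [Complex.cpow_def_of_ne_zero (mul_ne_zero hs' hx), Complex.log_ofReal_mul hs hx,
    Complex.ofReal_log hs.le, add_mul, Complex.exp_add, ← Complex.cpow_def_of_ne_zero hs',
    ← Complex.cpow_def_of_ne_zero hx]

end Hardy

theorem proposition3p1 (p : ℝ) (hp : 1 < p) (N : ℕ) (hN : 1 ≤ N) (a : Fin N → ℂ)
    (ha : ∀ k, a k ∈ Hardy.disk \ {0}) :
    (∃ h : ℂ → ℂ,
      Hardy.IsExtremal p (Hardy.blaschke a) h ∧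
      (∀ g : ℂ → ℂ, Hardy.IsExtremal p (Hardy.blaschke a) g → Set.EqOn g h Hardy.disk) ∧
      (∀ z ∈ Hardy.disk, 1 - Hardy.blaschke a z * h z =
        (1 - (starRingEnd ℂ) (Hardy.blaschke a 0) * Hardy.blaschke a z) ^ ((2 / p : ℝ) : ℂ)) ∧
      (∃ (d : ℕ) (w : Fin d → ℂ), d ≤ N - 1 ∧
        (∀ k, w k ∈ Metric.closedBall (0 : ℂ) 1 \ {0}) ∧
        (∀ z ∈ Hardy.disk, 1 - Hardy.blaschke a z * h z =
          ((Hardy.scale a ^ (2 / p) : ℝ) : ℂ) * Hardy.ratio a w z ^ ((2 / p : ℝ) : ℂ)) ∧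
        Hardy.Consistent a w ∧
        (Function.Injective a →
          ∀ (d' : ℕ) (w' : Fin d' → ℂ), d' ≤ N - 1 → (∀ k, w' k ≠ 0) → Hardy.Consistent a w' →
            ∃ e : Fin d' ≃ Fin d, w' = w ∘ e)) ∧
      (∀ k, N = 1 → ∀ z ∈ Hardy.disk, 1 - Hardy.blaschke a z * h z =
        (((1 - ‖a k‖ ^ 2 : ℝ) : ℂ) / (1 - (starRingEnd ℂ) (a k) * z)) ^ ((2 / p : ℝ) : ℂ))) ∧
    Hardy.hpDist p 1 (Hardy.invariantSubspace p (Hardy.blaschke a)) =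
      ENNReal.ofReal ((1 - ‖Hardy.blaschke a 0‖ ^ 2) ^ (1 / p)) := by
  have ha1 : ∀ k, ‖a k‖ < 1 := fun k => Hardy.mem_disk.1 (ha k).1
  have hJ := Hardy.isInner_blaschke ha1
  have h0 := Hardy.norm_blaschke_zero_lt_one hN ha1
  have hs := Hardy.scale_pos hN ha1
  obtain ⟨d, w, hd, hw, hfac⟩ := Hardy.exists_factor_eq_scale_mul_ratio hN ha1
  have hcons : Hardy.Consistent a w := fun j => by
    rw [← hfac _ (ha j).1, Hardy.blaschke_apply_self, mul_zero, sub_zero]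
  refine ⟨⟨Hardy.extremal p (Hardy.blaschke a), hJ.isExtremal_extremal h0 hp,
    fun g hg => hJ.eqOn_extremal h0 hp hg, fun z _ => Hardy.one_sub_mul_extremal p _ z,
    ⟨d, w, hd, hw, fun z hz => ?_, hcons, fun hinj d' w' hd' hw' hcons' =>
      hcons.exists_equiv hcons' ha1 hinj (by omega) (by omega) (fun k => (hw k).2) hw'⟩,
    fun k hN1 z hz => ?_⟩, hJ.hpDist_eq h0 (Hardy.diffContOnCl_blaschke ha1) hp⟩
  · rw [Hardy.one_sub_mul_extremal, hfac z hz, Hardy.ofReal_mul_cpow hs.le,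
      Complex.ofReal_cpow hs.le]
  · subst hN1
    obtain rfl : d = 0 := by omega
    obtain rfl : k = 0 := Subsingleton.elim _ _
    rw [Hardy.one_sub_mul_extremal, hfac z hz]
    congr 1
    simp [Hardy.scale, Hardy.ratio, div_eq_mul_inv]
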